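/- Let $n\ge 2$ and let $\mathbb K$ be a field. An $n$-linear form on a finite-dimensional $\mathbb K$-vector space $U$ is a map $F\colon U^n\to\mathbb K$ that is linear in each argument. Two $n$-linear forms $F\colon U^n\to\mathbb K$ and $G\colon V^n\to\mathbb K$ are called *symmetrically equivalent* if there are linear bijections $\varphi_1,\dots,\varphi_n\colon U\to V$ such that $$F(u_1,\dots,u_n)=G(\varphi_{i_1}u_1,\dots,\varphi_{i_n}u_n)$$ for all $u_1,\dots,u_n\in U$ and each reordering $i_1,\dots,i_n$ of $1,\dots,n$. They are called *congruent* if there is a single linear bijection $\varphi\colon U\to V$ such that $F(u_1,\dots,u_n)=G(\varphi u_1,\dots,\varphi u_n)$ for all $u_1,\dots,u_n\in U$. We write $F=F_1\oplus\dots\oplus F_m$ if there is a decomposition $U=U_1\oplus\dots\oplus U_m$ into a direct sum of subspaces such that $F_a$ is the restriction $F|U_a$ for each $a$, and $F(x_1,\dots,x_n)=0$ whenever $x_i\in U_a$ and $x_j\in U_b$ for some $i,j$ and some $a\ne b$. A form $F$ is *indecomposable* if for each decomposition $F=F_1\oplus F_2$, with corresponding decomposition $U=U_1\oplus U_2$,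 we have $U_1=0$ or $U_2=0$. **Theorem.** (a) If two $n$-linear forms over $\mathbb C$ are symmetrically equivalent, then they are congruent. (b) Let $F$ and $G$ be symmetrically equivalent $n$-linear forms over $\mathbb R$, and let $$F=F_1\oplus\dots\oplus F_s\oplus 0,\qquad G=G_1\oplus\dots\oplus G_r\oplus 0$$ be decompositions in which all summands $F_i$ and $G_j$ are nonzero and indecomposable, and the last summand of each is the zero form on a (possibly zero) subspace. Then $s=r$ and, after a suitable reindexing of $G_1,\dots,G_r$, each $F_i$ is congruent to $G_i$ or to $-G_i$. -/

import Mathlib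

namespace MultilinearForm

variable {K : Type*} [Field K] {n : ℕ}
variable {U : Type*} [AddCommGroup U] [Module K U]
variable {V : Type*} [AddCommGroup V] [Module K V]

/-- An `n`-linear form `U × ⋯ × U → K`. -/
abbrev Form (K : Type*) [Field K] (n : ℕ) (U : Type*) [AddCommGroup U] [Module K U] :=
  MultilinearMap K (fun _ : Fin n => U) K

/-- Symmetric equivalence: there are linear bijections `φ₁, …, φₙ : U → V` with
`F(u₁, …, uₙ) = G(φ_{i₁} u₁, …, φ_{iₙ} uₙ)` for all vectors and each reordering
`i₁, …, iₙ` of `1, …, n`. -/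
def SymmetricallyEquivalent (F : Form K n U) (G : Form K n V) : Prop :=
  ∃ φ : Fin n → (U ≃ₗ[K] V), ∀ (σ : Equiv.Perm (Fin n)) (u : Fin n → U),
    F u = G (fun k => φ (σ k) (u k))

/-- Congruence: there is one linear bijection `φ : U → V` with
`F(u₁, …, uₙ) = G(φ u₁, …, φ uₙ)` for all vectors. -/
def Congruent (F : Form K n U) (G : Form K n V) : Prop :=
  ∃ φ : U ≃ₗ[K] V, ∀ u : Fin n → U, F u = G (fun k => φ (u k))

/-- The restriction `F|W` of a form to a subspace `W`. -/
def restrict (F : Form K n U) (W : Submodule K U) : Form K n W :=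
  F.compLinearMap (fun _ => W.subtype)

/-- `F` is the (internal) direct sum of its restrictions `F|W_a`: the space is the direct sum of
the subspaces `W_a`, and `F(x₁, …, xₙ) = 0` as soon as two of the arguments lie in two different
subspaces of the family (the other arguments being arbitrary). -/
structure IsDirectSum {ι : Type*} [DecidableEq ι] (F : Form K n U) (W : ι → Submodule K U) :
    Prop where
  isInternal : DirectSum.IsInternal W
  eq_zero : ∀ a b : ι, a ≠ b → ∀ (x : Fin n → U) (i j : Fin n),
    x i ∈ W a → x j ∈ W b → F x = 0

/-- `F` is indecomposable: in each decomposition `F = F₁ ⊕ F₂`, one of the two corresponding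
subspaces is zero. -/
def Indecomposable (F : Form K n U) : Prop :=
  ∀ W : Fin 2 → Submodule K U, IsDirectSum F W → W 0 = ⊥ ∨ W 1 = ⊥

/-- A decomposition `F = F₁ ⊕ ⋯ ⊕ F_s ⊕ 0`, where `F_i = F|W_i` is nonzero and indecomposable and
the last summand is the zero form on the subspace `W₀` (which may be the zero space). -/
structure IsIndecomposableDecomposition {s : ℕ} (F : Form K n U)
    (W : Fin s → Submodule K U) (W₀ : Submodule K U) : Prop where
  isDirectSum : IsDirectSum F (fun i : Option (Fin s) => i.elim W₀ W)
  ne_zero : ∀ i, restrict F (W i) ≠ 0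
  indecomposable : ∀ i, Indecomposable (restrict F (W i))
  eq_zero : restrict F W₀ = 0

end MultilinearForm

/-!
Call an operator `s` selfadjoint for a form `G` if it can be moved from one argument of `G` to any
other. If `G(φ_{i₁} ·, …, φ_{iₙ} ·)` does not depend on the reordering, the quotients
`φ_q φ_p⁻¹` are selfadjoint. When such a quotient is `c tⁿ`, with `t` a polynomial in it, the factors
`t` can be spread over the `n` arguments, which makes `φ_q` and `φ_p` equal at the cost of the scalar
`c` (`exists_congruent_smul`). Over `ℂ` every invertible operator is an `n`-th power of this kind, so
symmetrically equivalent forms are congruent. Over `ℝ` an invertible selfadjoint operator of an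
indecomposable form is `± tⁿ` by Fitting's lemma (`Indecomposable.exists_aeval_pow_eq_real`), so
symmetrically equivalent indecomposable forms are congruent up to sign.

It remains to match the summands of two real decompositions `U = ⨁ U_i` and `V = ⨁ V_j`. The
blocks of `φ_p` and `φ_q⁻¹` between `U_i` and `V_j` form an adjoint pair of maps `α : U_i → V_j` and
`γ : V_j → U_i`. If some adjoint pair consists of bijections, `F_i` and `G_j` are symmetrically
equivalent. Otherwise all the selfadjoint operators `γ α` are nilpotent. Nilpotent selfadjoint
operators of an indecomposable real form are closed under addition, so polarization gives
`tr (γ α') + tr (γ' α) = 0` (`bijective_or_trace_add_trace_eq_zero`). Hence the matrix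
`T_{ij} = tr (U_i → V_j → U_i)`, computed with the blocks of `φ_p`, `φ_p⁻¹` and added to the same for
`φ_q`, is supported on the pairs of forms that are congruent up to sign. Its row sums are `2 dim U_i`
and its column sums `2 dim V_j`: an entry between a nonzero summand and a zero one is `0` because
zero summands lie in the radicals. Counting a sign-congruence class through rows and through columns
shows that it has equally many members on both sides
(`SymmetricallyEquivalent.exists_equiv_signCongruent`).
-/

namespace MultilinearForm

open Function Polynomial

/-! ### Adjoint pairs, Fitting's lemma and the radical -/

section Adjoint

variable {K : Type*} [Field K] {n : ℕ}
variable {U : Type*} [AddCommGroup U] [Module K U]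

/-- `A` applied to the `i`-th argument of `F` has the same effect as `B` applied to the `j`-th one,
for all `i ≠ j`. The operator `A` is called selfadjoint for `F` if `AdjointPair F A A`. -/
def AdjointPair (F : Form K n U) (A B : Module.End K U) : Prop :=
  ∀ (x : Fin n → U) (i j : Fin n), i ≠ j → F (update x i (A (x i))) = F (update x j (B (x j)))

namespace AdjointPair

variable {F : Form K n U} {A B A' B' : Module.End K U}

/-- Adjoint pairs compose like operators paired with their transposes, the second factors in the
opposite order. -/
theorem mul (h : AdjointPair F A B) (h' : AdjointPair F A' B') :
    AdjointPair F (A * A') (B' * B) := by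
  intro x i j hij
  have h1 := h (update x i (A' (x i))) i j hij
  have h2 := h' (update x j (B (x j))) i j hij
  simp only [update_self, update_idem, update_of_ne hij, update_of_ne hij.symm] at h1 h2
  rw [update_comm hij.symm] at h2
  simpa using h1.trans (by rw [update_comm hij]; rw [update_comm hij] at h2; exact h2)

theorem add (h : AdjointPair F A B) (h' : AdjointPair F A' B') :
    AdjointPair F (A + A') (B + B') := by
  intro x i j hij
  simp only [LinearMap.add_apply, MultilinearMap.map_update_add, h x i j hij, h' x i j hij]

theorem smul (c : K) (h : AdjointPair F A B) : AdjointPair F (c • A) (c • B) := by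
  intro x i j hij
  simp only [LinearMap.smul_apply, MultilinearMap.map_update_smul, h x i j hij]

theorem one : AdjointPair F 1 1 := by
  intro x i j _
  simp

theorem aeval (h : AdjointPair F A A) (p : K[X]) :
    AdjointPair F (Polynomial.aeval A p) (Polynomial.aeval A p) := by
  induction p using Polynomial.induction_on' with
  | add p q hp hq => simpa using hp.add hq
  | monomial k c =>
    rw [Polynomial.aeval_monomial, ← Algebra.smul_def]
    apply AdjointPair.smul
    induction k with
    | zero => simpa using one
    | succ k ih =>
      have := ih.mul h
      rwa [← pow_succ, ← pow_succ'] at this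

theorem pow (h : AdjointPair F A A) (k : ℕ) : AdjointPair F (A ^ k) (A ^ k) := by
  simpa using h.aeval (Polynomial.X ^ k)

theorem inverse (h : AdjointPair F A A) (h1 : A * B = 1) :
    AdjointPair F B B := by
  intro x i j hij
  have := h (update (update x i (B (x i))) j (B (x j))) i j hij
  have hA : ∀ y, A (B y) = y := fun y => by rw [← Module.End.mul_apply, h1]; rfl
  simp only [update_self, update_idem, update_of_ne hij, hA] at this
  have e1 : update (update (update x i (B (x i))) j (B (x j))) i (x i)
      = update x j (B (x j)) := by
    rw [update_comm hij.symm, update_idem, update_eq_self]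
  have e2 : update (update x i (B (x i))) j (x j) = update x i (B (x i)) := by
    rw [update_comm hij, update_eq_self]
  rw [e1, e2] at this
  exact this.symm

/-- The factors of a power of a selfadjoint operator in one argument can be spread over any set of
arguments of that size. -/
theorem apply_piecewise (h : AdjointPair F A A) (i : Fin n) (S : Finset (Fin n))
    (x : Fin n → U) :
    F (S.piecewise (fun k => A (x k)) x) = F (update x i ((A ^ S.card) (x i))) := by
  induction S using Finset.induction_on generalizing x with
  | empty => simp
  | insert a S ha ih =>
    rw [Finset.card_insert_of_notMem ha]
    have e : (insert a S).piecewise (fun k => A (x k)) x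
        = S.piecewise (fun k => A (update x a (A (x a)) k)) (update x a (A (x a))) := by
      ext k
      by_cases hk : k = a
      · subst hk; simp [ha]
      · by_cases hS : k ∈ S <;> simp [hk, hS]
    rw [e, ih]
    by_cases hai : a = i
    · subst hai; simp [pow_succ]
    · have := h (update x i ((A ^ S.card) (x i))) a i hai
      simp only [update_self, update_idem, update_of_ne hai] at this
      rw [update_of_ne (Ne.symm hai), update_comm hai, pow_succ']
      simpa using this

theorem apply_comp (h : AdjointPair F A A) (i : Fin n) (x : Fin n → U) :
    F (fun k => A (x k)) = F (update x i ((A ^ n) (x i))) := by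
  simpa using h.apply_piecewise i Finset.univ x

end AdjointPair

/-- Fitting's lemma for forms: for a selfadjoint `s` and large `N`, the kernel and the range of
`s ^ N` decompose `F`, since `F(x, s ^ N z, …) = F(s ^ N x, z, …)`. -/
theorem Indecomposable.isNilpotent_or_isUnit [FiniteDimensional K U] {F : Form K n U}
    (hF : Indecomposable F) {s : Module.End K U} (hs : AdjointPair F s s) :
    IsNilpotent s ∨ IsUnit s := by
  obtain ⟨N, hN⟩ := Filter.eventually_atTop.1 (LinearMap.eventually_isCompl_ker_pow_range_pow s)
  have hc := hN (N + 1) (by omega)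
  have hp := hs.pow (N + 1)
  have key : ∀ (x : Fin n → U) (i j : Fin n), x i ∈ LinearMap.ker (s ^ (N + 1)) →
      x j ∈ LinearMap.range (s ^ (N + 1)) → F x = 0 := by
    intro x i j hi hj
    by_cases hij : i = j
    · subst hij
      have : x i = 0 := by
        have := (Submodule.disjoint_def.1 hc.disjoint) _ hi hj
        exact this
      exact F.map_coord_zero i this
    · obtain ⟨z, hz⟩ := hj
      have := hp (update x j z) i j hij
      simp only [update_self, update_idem, update_of_ne hij, hz, update_eq_self] at this
      rw [← this, LinearMap.mem_ker.1 hi]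
      exact F.map_coord_zero i (by simp)
  rcases hF ![LinearMap.ker (s ^ (N + 1)), LinearMap.range (s ^ (N + 1))]
    ⟨(DirectSum.isInternal_submodule_iff_isCompl _ (i := 0) (j := 1) (by simp)
      (by ext k; fin_cases k <;> simp)).2 (by simpa using hc), by
      intro a b hab x i j hi hj
      fin_cases a <;> fin_cases b
      · exact absurd rfl hab
      · exact key x i j hi hj
      · exact key x j i hj hi
      · exact absurd rfl hab⟩ with h | h
  · right
    have h : LinearMap.ker (s ^ (N + 1)) = ⊥ := h
    have : IsUnit (s ^ (N + 1)) := (LinearMap.isUnit_iff_ker_eq_bot _).2 h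
    exact (isUnit_pow_iff (by omega)).1 this
  · left
    exact ⟨N + 1, LinearMap.range_eq_bot.1 h⟩

/-- The vectors that annihilate `F` in whichever position they are placed. -/
def radical (F : Form K n U) : Submodule K U where
  carrier := {u | ∀ (x : Fin n → U) (i : Fin n), F (update x i u) = 0}
  add_mem' := by
    intro u v hu hv x i
    rw [F.map_update_add, hu, hv, add_zero]
  zero_mem' := fun x i => F.map_coord_zero i (by simp)
  smul_mem' := by
    intro c u hu x i
    rw [F.map_update_smul, hu, smul_zero]

theorem eq_zero_of_mem_radical {F : Form K n U} {x : Fin n → U} {i : Fin n}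
    (h : x i ∈ radical F) : F x = 0 := by
  simpa using h x i

/-- Any complement of the radical splits off from the form, so a nonzero indecomposable form has
zero radical. -/
theorem Indecomposable.radical_eq_bot {F : Form K n U} (hn : 0 < n)
    (hF : Indecomposable F) (h0 : F ≠ 0) : radical F = ⊥ := by
  obtain ⟨C, hC⟩ := (radical F).exists_isCompl
  rcases hF ![radical F, C]
    ⟨(DirectSum.isInternal_submodule_iff_isCompl _ (i := 0) (j := 1) (by simp)
      (by ext k; fin_cases k <;> simp)).2 (by simpa using hC), by
      intro a b hab x i j hi hj
      fin_cases a <;> fin_cases b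
      · exact absurd rfl hab
      · exact eq_zero_of_mem_radical hi
      · exact eq_zero_of_mem_radical hj
      · exact absurd rfl hab⟩ with h | h
  · exact h
  · exfalso
    have h : C = ⊥ := h
    subst h
    have ht := hC.sup_eq_top
    rw [sup_bot_eq] at ht
    apply h0
    ext x
    exact eq_zero_of_mem_radical (i := ⟨0, hn⟩) (by rw [ht]; trivial)

end Adjoint

/-! ### Roots of selfadjoint operators -/

section Roots

/-- Newton's method: an `m`-th root of `c • s` modulo nilpotents that is a polynomial in `s` can be
corrected to a genuine root that is a polynomial in `s`. -/
theorem exists_aeval_pow_eq {K : Type*} [Field K] [CharZero K] {U : Type*} [AddCommGroup U]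
    [Module K U] [FiniteDimensional K U] {s : Module.End K U} (hs : IsUnit s) {m : ℕ}
    (hm : 0 < m) {q : K[X]} {c : K} (hc : c ≠ 0) (hq : IsNilpotent (aeval s q ^ m - c • s)) :
    ∃ p : K[X], aeval s p ^ m = c • s := by
  let S := Algebra.adjoin K {s}
  -- Newton's method needs a commutative ring: the algebra generated by `s`.
  have := Algebra.isMulCommutative_adjoin K (s := {s}) (by simp)
  let s' : S := ⟨s, Algebra.self_mem_adjoin_singleton K s⟩
  have hinj : Function.Injective S.val := Subtype.val_injective
  have hs' : IsUnit s' := by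
    have : FiniteDimensional K S := inferInstance
    have : IsArtinianRing S := IsArtinianRing.of_finite K S
    refine IsArtinianRing.isUnit_of_mem_nonZeroDivisors ?_
    rw [mem_nonZeroDivisors_iff_right]
    intro x hx
    apply hinj
    have : (x : Module.End K U) * s = 0 := congrArg S.val hx
    simpa using (hs.mul_left_eq_zero).1 this
  let y : S := ⟨aeval s q, Polynomial.aeval_mem_adjoin_singleton K s⟩
  have hy : IsNilpotent (y ^ m - c • s') := by
    obtain ⟨k, hk⟩ := hq
    exact ⟨k, hinj (by simpa using hk)⟩
  have hcs : IsUnit (c • s') := by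
    rw [Algebra.smul_def]
    exact ((Ne.isUnit hc).map _).mul hs'
  have hyu : IsUnit y := by
    have : IsUnit (y ^ m) := by
      have := hy.isUnit_add_left_of_commute hcs (Commute.all _ _)
      simpa using this
    exact (isUnit_pow_iff hm.ne').1 this
  obtain ⟨r, ⟨-, hr⟩, -⟩ := Polynomial.existsUnique_nilpotent_sub_and_aeval_eq_zero (R := S)
    (S := S) (P := X ^ m - C (c • s')) (x := y) (by simpa using hy) (by
      have : IsUnit ((m : S)) := by
        have : (m : S) = algebraMap K S m := by simp
        rw [this]
        exact (Ne.isUnit (by exact_mod_cast hm.ne')).map _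
      simpa [derivative_X_pow] using this.mul (hyu.pow (m - 1)))
  obtain ⟨p, hp⟩ := (Algebra.adjoin_singleton_eq_range_aeval K s ▸ r.2 :
    (r : Module.End K U) ∈ (aeval s : K[X] →ₐ[K] _).range)
  refine ⟨p, ?_⟩
  have hr' : r ^ m = c • s' := by simpa [sub_eq_zero] using hr
  have := congrArg S.val hr'
  have hp : aeval s p = (r : Module.End K U) := hp
  rw [hp]
  simpa using this

/-- Lagrange interpolation through `m`-th roots of the eigenvalues of `s` gives a root modulo
nilpotents. -/
theorem exists_aeval_pow_eq_complex {U : Type*} [AddCommGroup U]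
    [Module ℂ U] [FiniteDimensional ℂ U] {s : Module.End ℂ U} (hs : IsUnit s) {m : ℕ}
    (hm : 0 < m) : ∃ p : ℂ[X], aeval s p ^ m = s := by
  have hroot : ∀ z : ℂ, ∃ w : ℂ, w ^ m = z := fun z => IsAlgClosed.exists_pow_nat_eq z hm
  choose w hw using hroot
  let q := Lagrange.interpolate (minpoly ℂ s).roots.toFinset id w
  have hr : ∀ z ∈ (minpoly ℂ s).roots, X - C z ∣ q ^ m - X := by
    intro z hz
    have : q.eval z = w z :=
      Lagrange.eval_interpolate_at_node (v := id) w (Function.injective_id.injOn)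
        (Multiset.mem_toFinset.2 hz)
    rw [dvd_iff_isRoot]
    simp [this, hw]
  have hdvd : minpoly ℂ s ∣ (q ^ m - X) ^ (minpoly ℂ s).roots.card := by
    rw [(IsAlgClosed.splits (minpoly ℂ s)).eq_prod_roots_of_monic
      (minpoly.monic (Algebra.IsIntegral.isIntegral s))]
    rw [roots_multiset_prod_X_sub_C]
    revert hr
    generalize (minpoly ℂ s).roots = R
    intro hr
    induction R using Multiset.induction_on with
    | empty => simp
    | cons a R ih =>
      rw [Multiset.map_cons, Multiset.prod_cons, Multiset.card_cons, pow_succ']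
      exact mul_dvd_mul (hr a (by simp)) (ih fun z hz => hr z (by simp [hz]))
  have hnil : IsNilpotent (aeval s q ^ m - (1 : ℂ) • s) := by
    refine ⟨(minpoly ℂ s).roots.card, ?_⟩
    have := (minpoly.dvd_iff (A := ℂ) (x := s)).1 hdvd
    simpa using this
  simpa using exists_aeval_pow_eq hs hm one_ne_zero hnil

/-- Every complex `z` has, up to sign, an `m`-th root in `ℝ[z]`. The sign is needed only for
negative real `z`. -/
theorem exists_real_poly (z : ℂ) {m : ℕ} (hm : 0 < m) :
    ∃ (q : ℝ[X]) (c : ℝ), (c = 1 ∨ c = -1) ∧ aeval z (q ^ m - C c * X) = 0 := by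
  by_cases hz : z.im = 0
  · have hzr : z = (z.re : ℂ) := Complex.ext rfl (by simpa using hz)
    rcases le_total 0 z.re with h | h
    · refine ⟨C (z.re ^ ((m : ℝ)⁻¹)), 1, Or.inl rfl, ?_⟩
      have := Real.rpow_inv_natCast_pow h hm.ne'
      rw [hzr]
      simp only [map_sub, map_pow, map_mul, aeval_C, aeval_X, Complex.coe_algebraMap,
        Complex.ofReal_re]
      rw [← Complex.ofReal_pow, this]; simp
    · refine ⟨C ((-z.re) ^ ((m : ℝ)⁻¹)), -1, Or.inr rfl, ?_⟩
      have := Real.rpow_inv_natCast_pow (neg_nonneg.2 h) hm.ne'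
      rw [hzr]
      simp only [map_sub, map_pow, map_mul, aeval_C, aeval_X, Complex.coe_algebraMap,
        Complex.ofReal_re]
      rw [← Complex.ofReal_pow, this]; simp
  · obtain ⟨w, hw⟩ := IsAlgClosed.exists_pow_nat_eq z hm
    -- As `z` is not real, `1` and `z` span `ℂ` over `ℝ`, so `w` is a real affine function of `z`.
    refine ⟨C (w.re - w.im / z.im * z.re) + C (w.im / z.im) * X, 1, Or.inl rfl, ?_⟩
    have : aeval z (C (w.re - w.im / z.im * z.re) + C (w.im / z.im) * X : ℝ[X]) = w := by
      apply Complex.ext <;> simp [hz]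
    rw [map_sub, map_pow, this, hw]
    simp

/-- By Fitting's lemma the minimal polynomial of `s` is a power of a single irreducible `g`; a signed
`m`-th root of a complex zero of `g` is then a signed root of `s` modulo nilpotents. -/
theorem Indecomposable.exists_aeval_pow_eq_real {n : ℕ} {U : Type*} [AddCommGroup U]
    [Module ℝ U] [FiniteDimensional ℝ U] {F : Form ℝ n U} (hF : Indecomposable F)
    {s : Module.End ℝ U} (hs : AdjointPair F s s) (hu : IsUnit s) {m : ℕ} (hm : 0 < m) :
    ∃ (p : ℝ[X]) (c : ℝ), (c = 1 ∨ c = -1) ∧ s = c • aeval s p ^ m := by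
  rcases subsingleton_or_nontrivial U with hU | hU
  · exact ⟨0, 1, Or.inl rfl, Subsingleton.elim _ _⟩
  have hint := Algebra.IsIntegral.isIntegral (R := ℝ) s
  obtain ⟨g, hg, hgd⟩ := WfDvdMonoid.exists_irreducible_factor (minpoly.not_isUnit ℝ s)
    (minpoly.ne_zero hint)
  have hnil : IsNilpotent (aeval s g) := by
    refine (hF.isNilpotent_or_isUnit (hs.aeval g)).resolve_right fun hgu => ?_
    obtain ⟨h, hh⟩ := hgd
    have h0 : aeval s g * aeval s h = 0 := by rw [← map_mul, ← hh, minpoly.aeval]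
    have h1 : aeval s h = 0 := (hgu.mul_right_eq_zero).1 h0
    have h2 : minpoly ℝ s ∣ h := minpoly.dvd ℝ s h1
    obtain ⟨k, hk⟩ := h2
    have hne := minpoly.ne_zero hint
    apply hg.not_isUnit
    refine IsUnit.of_mul_eq_one k ?_
    apply mul_left_cancel₀ hne
    calc minpoly ℝ s * (g * k) = g * (minpoly ℝ s * k) := by ring
      _ = minpoly ℝ s * 1 := by rw [← hk, ← hh, mul_one]
  obtain ⟨z, hz⟩ := IsAlgClosed.exists_aeval_eq_zero ℂ g hg.degree_pos.ne'
  obtain ⟨q, c, hc, hq⟩ := exists_real_poly z hm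
  have hgq : g ∣ q ^ m - C c * X := by
    have h1 := minpoly.eq_of_irreducible hg hz
    have h2 := minpoly.dvd ℝ z hq
    rw [← h1] at h2
    exact (dvd_mul_right _ _).trans h2
  have hc0 : c ≠ 0 := by rcases hc with rfl | rfl <;> norm_num
  have hnil' : IsNilpotent (aeval s q ^ m - c • s) := by
    obtain ⟨h, hh⟩ := hgq
    have : aeval s q ^ m - c • s = aeval s g * aeval s h := by
      rw [← map_mul, ← hh]; simp [Algebra.smul_def]
    rw [this]
    exact Commute.isNilpotent_mul_right ((Commute.all g h).map (aeval s)) hnil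
  obtain ⟨p, hp⟩ := exists_aeval_pow_eq hu hm hc0 hnil'
  refine ⟨p, c, hc, ?_⟩
  rw [hp, smul_smul]
  rcases hc with rfl | rfl <;> simp

end Roots

/-! ### From symmetric equivalence to congruence -/

section Congruence

variable {K : Type*} [Field K] {n : ℕ}
variable {U : Type*} [AddCommGroup U] [Module K U]
variable {V : Type*} [AddCommGroup V] [Module K V]

theorem exists_perm_apply_eq {a b p q : Fin n} (hab : a ≠ b) (hpq : p ≠ q) :
    ∃ σ : Equiv.Perm (Fin n), σ a = p ∧ σ b = q := by
  have h1 : Equiv.swap a p b ≠ p := fun h => hab (by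
    rw [Equiv.swap_apply_eq_iff, Equiv.swap_apply_right] at h; exact h.symm)
  exact ⟨Equiv.swap (Equiv.swap a p b) q * Equiv.swap a p, by
    simp [Equiv.swap_apply_of_ne_of_ne h1.symm hpq], by simp⟩

/-- The quotient of two of the bijections of a symmetric equivalence is selfadjoint for the target
form: compare two reorderings that differ by a transposition. -/
theorem adjointPair_of_symmetric {F : Form K n U} {G : Form K n V} {c : K} (hc : c ≠ 0)
    {φ : Fin n → (U ≃ₗ[K] V)}
    (hφ : ∀ (σ : Equiv.Perm (Fin n)) (u : Fin n → U), F u = c * G (fun k => φ (σ k) (u k)))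
    {p q : Fin n} (hpq : p ≠ q) :
    AdjointPair G ((φ q : U →ₗ[K] V) ∘ₗ ((φ p).symm : V →ₗ[K] U))
      ((φ q : U →ₗ[K] V) ∘ₗ ((φ p).symm : V →ₗ[K] U)) := by
  intro v a b hab
  obtain ⟨σ, ha, hb⟩ := exists_perm_apply_eq hab hpq
  let u : Fin n → U := fun k =>
    if k = a then (φ p).symm (v a) else if k = b then (φ p).symm (v b)
    else (φ (σ k)).symm (v k)
  have h1 := hφ σ u
  have h2 := hφ (σ * Equiv.swap a b) u
  have e1 : (fun k => φ (σ k) (u k)) = update v b (φ q ((φ p).symm (v b))) := by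
    funext k
    by_cases hka : k = a
    · subst hka; simp [u, ha, hab]
    · by_cases hkb : k = b
      · subst hkb; simp [u, hb, hka]
      · simp [u, hka, hkb]
  have e2 : (fun k => φ ((σ * Equiv.swap a b) k) (u k))
      = update v a (φ q ((φ p).symm (v a))) := by
    funext k
    by_cases hka : k = a
    · subst hka; simp [u, hb]
    · by_cases hkb : k = b
      · subst hkb; simp [u, ha, hka]
      · simp [u, hka, hkb, Equiv.swap_apply_of_ne_of_ne hka hkb]
  rw [e1] at h1
  rw [e2, h1] at h2
  exact (mul_left_cancel₀ hc h2).symm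

/-- If `s = φ q ∘ (φ p)⁻¹` equals `c • t ^ n` with `t` selfadjoint, then replacing `φ q` by `φ p` and
composing all the bijections with `t` gives a symmetric equivalence with one more bijection equal to
`φ p`, up to the scalar `c`. Repeating this makes all the bijections equal. -/
theorem exists_congruent_smul (hn : 0 < n) (S : Submonoid K) (hS : ∀ c ∈ S, c ≠ 0)
    {F : Form K n U} {G : Form K n V}
    (hroot : ∀ s : Module.End K V, AdjointPair G s s → IsUnit s →
      ∃ (t : Module.End K V) (c : K), c ∈ S ∧ AdjointPair G t t ∧ s = c • t ^ n)
    (hFG : SymmetricallyEquivalent F G) : ∃ c ∈ S, Congruent F (c • G) := by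
  obtain ⟨φ, hφ⟩ := hFG
  -- Induction on the number of bijections that differ from the first one.
  suffices H : ∀ (N : ℕ) (φ : Fin n → (U ≃ₗ[K] V)) (c : K), c ∈ S →
      (∀ (σ : Equiv.Perm (Fin n)) (u : Fin n → U), F u = c * G (fun k => φ (σ k) (u k))) →
      {k | φ k ≠ φ ⟨0, hn⟩}.ncard = N → ∃ c ∈ S, Congruent F (c • G) from
    H _ φ 1 S.one_mem (by simpa using hφ) rfl
  clear hφ φ
  intro N
  induction N using Nat.strong_induction_on with
  | _ N ih =>
  intro φ c hc hφ hN
  by_cases hall : ∀ k, φ k = φ ⟨0, hn⟩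
  · refine ⟨c, hc, φ ⟨0, hn⟩, fun u => ?_⟩
    rw [hφ 1 u, smul_apply, smul_eq_mul]
    congr 2
    funext k
    rw [hall]
  · push Not at hall
    obtain ⟨j, hj⟩ := hall
    have hj0 : (⟨0, hn⟩ : Fin n) ≠ j := fun h => hj (by rw [h])
    have hsa := adjointPair_of_symmetric (hS c hc) hφ hj0
    obtain ⟨t, d, hd, ht, hst⟩ := hroot _ hsa (by
      rw [Module.End.isUnit_iff]
      exact ((φ ⟨0, hn⟩).symm.trans (φ j)).bijective)
    have htu : IsUnit t := by
      have hsu : IsUnit (d • t ^ n) := by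
        rw [← hst, Module.End.isUnit_iff]
        exact ((φ ⟨0, hn⟩).symm.trans (φ j)).bijective
      rw [Algebra.smul_def, (Algebra.commute_algebraMap_left d (t ^ n)).isUnit_mul_iff] at hsu
      exact (isUnit_pow_iff hn.ne').1 hsu.2
    let τ : V ≃ₗ[K] V := LinearEquiv.ofBijective t ((Module.End.isUnit_iff t).1 htu)
    have hτ : ∀ v, τ v = t v := fun v => rfl
    let ψ : Fin n → (U ≃ₗ[K] V) := fun k => (if k = j then φ ⟨0, hn⟩ else φ k).trans τ
    refine ih _ ?_ ψ (c * d) (S.mul_mem hc hd) ?_ rfl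
    · rw [← hN]
      refine Set.ncard_lt_ncard ⟨fun k hk => ?_, fun hsub => ?_⟩ (Set.toFinite _)
      · intro hk'
        apply hk
        by_cases hkj : k = j
        · simp [ψ, hkj]
        · simp [ψ, hkj, hj0, hk']
      · exact hsub (a := j) hj (by simp [ψ, hj0])
    · intro σ u
      let v : Fin n → V := fun k => (if σ k = j then φ ⟨0, hn⟩ else φ (σ k)) (u k)
      have e1 : (fun k => ψ (σ k) (u k)) = fun k => t (v k) := rfl
      have e2 : (fun k => φ (σ k) (u k))
          = update v (σ.symm j) (d • (t ^ n) (v (σ.symm j))) := by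
        funext k
        by_cases hk : k = σ.symm j
        · subst hk
          have := LinearMap.congr_fun hst (v (σ.symm j))
          rw [update_self, ← LinearMap.smul_apply, ← this]
          simp [v]
        · have hk' : σ k ≠ j := fun h => hk (by rw [← h]; simp)
          simp [hk, v, hk']
      rw [e1, ht.apply_comp (σ.symm j) v, hφ σ u, e2, G.map_update_smul, smul_eq_mul, mul_assoc]

theorem congruent_of_symmetricallyEquivalent_complex {n : ℕ} (hn : 0 < n) {U V : Type*}
    [AddCommGroup U] [Module ℂ U] [AddCommGroup V] [Module ℂ V] [FiniteDimensional ℂ V]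
    {F : Form ℂ n U} {G : Form ℂ n V} (h : SymmetricallyEquivalent F G) : Congruent F G := by
  obtain ⟨c, hc, h⟩ := exists_congruent_smul hn ⊥ (by simp) (fun s hs hu => by
    obtain ⟨p, hp⟩ := exists_aeval_pow_eq_complex hu hn
    exact ⟨aeval s p, 1, by simp, hs.aeval p, by simp [hp]⟩) h
  simpa [Submonoid.mem_bot.1 hc] using h

/-- Congruence up to sign. -/
def SignCongruent (F : Form K n U) (G : Form K n V) : Prop := Congruent F G ∨ Congruent F (-G)

theorem Indecomposable.signCongruent {n : ℕ} (hn : 0 < n) {U V : Type*}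
    [AddCommGroup U] [Module ℝ U] [AddCommGroup V] [Module ℝ V] [FiniteDimensional ℝ V]
    {F : Form ℝ n U} {G : Form ℝ n V} (hG : Indecomposable G)
    (h : SymmetricallyEquivalent F G) : SignCongruent F G := by
  let S : Submonoid ℝ :=
    { carrier := {1, -1}
      one_mem' := by simp
      mul_mem' := by rintro a b (rfl | rfl) (rfl | rfl) <;> simp }
  obtain ⟨c, hc | hc, h⟩ := exists_congruent_smul hn S
    (by rintro c (rfl | rfl) <;> norm_num) (fun s hs hu => by
      obtain ⟨p, c, hc, hp⟩ := hG.exists_aeval_pow_eq_real hs hu hn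
      exact ⟨aeval s p, c, hc, hs.aeval p, hp⟩) h
  · left; simpa [hc] using h
  · right
    rw [show c = -1 from hc, show (-1 : ℝ) • G = -G by ext; simp] at h
    exact h

theorem Congruent.symm {F : Form K n U} {G : Form K n V} (h : Congruent F G) :
    Congruent G F := by
  obtain ⟨φ, hφ⟩ := h
  exact ⟨φ.symm, fun v => by simp [hφ]⟩

theorem Congruent.trans {X : Type*} [AddCommGroup X] [Module K X] {F : Form K n U}
    {G : Form K n V} {H : Form K n X} (h : Congruent F G) (h' : Congruent G H) :
    Congruent F H := by
  obtain ⟨φ, hφ⟩ := h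
  obtain ⟨ψ, hψ⟩ := h'
  exact ⟨φ.trans ψ, fun v => by simp [hφ, hψ]⟩

theorem Congruent.neg {F : Form K n U} {G : Form K n V} (h : Congruent F G) :
    Congruent (-F) (-G) := by
  obtain ⟨φ, hφ⟩ := h
  exact ⟨φ, fun v => by simp [hφ]⟩

theorem SignCongruent.symm {F : Form K n U} {G : Form K n V} (h : SignCongruent F G) :
    SignCongruent G F :=
  h.imp Congruent.symm fun h => by simpa using h.neg.symm

theorem SignCongruent.trans {X : Type*} [AddCommGroup X] [Module K X] {F : Form K n U}
    {G : Form K n V} {H : Form K n X} (h : SignCongruent F G) (h' : SignCongruent G H) :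
    SignCongruent F H := by
  rcases h with h | h <;> rcases h' with h' | h'
  · exact Or.inl (h.trans h')
  · exact Or.inr (h.trans h')
  · exact Or.inr (h.trans h'.neg)
  · exact Or.inl (by simpa using h.trans h'.neg)

theorem SignCongruent.refl (F : Form K n U) : SignCongruent F F :=
  Or.inl ⟨LinearEquiv.refl K U, fun _ => rfl⟩

theorem SignCongruent.finrank_eq {F : Form K n U} {G : Form K n V} (h : SignCongruent F G) :
    Module.finrank K U = Module.finrank K V := by
  rcases h with ⟨φ, -⟩ | ⟨φ, -⟩ <;> exact φ.finrank_eq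

end Congruence

/-! ### Traces of products of adjoint pairs -/

section Trace

/-- If `s + t` is not nilpotent, it is invertible, hence `± v ^ 2` with `v` selfadjoint. Then
`v⁻¹ s v⁻¹` and `v⁻¹ t v⁻¹` are selfadjoint, not invertible, hence nilpotent, but their sum is
`± 1`. -/
theorem Indecomposable.isNilpotent_add {n : ℕ} {U : Type*} [AddCommGroup U]
    [Module ℝ U] [FiniteDimensional ℝ U] {F : Form ℝ n U} (hF : Indecomposable F)
    {s t : Module.End ℝ U} (hs : AdjointPair F s s) (ht : AdjointPair F t t)
    (hs' : IsNilpotent s) (ht' : IsNilpotent t) : IsNilpotent (s + t) := by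
  rcases subsingleton_or_nontrivial U with hU | hU
  · exact ⟨1, Subsingleton.elim _ _⟩
  refine (hF.isNilpotent_or_isUnit (hs.add ht)).resolve_right fun hu => ?_
  obtain ⟨p, c, hc, hp⟩ := hF.exists_aeval_pow_eq_real (hs.add ht) hu two_pos
  have hv := (hs.add ht).aeval p
  set v := aeval (s + t) p
  have hc0 : c ≠ 0 := by rcases hc with rfl | rfl <;> norm_num
  have hvu : IsUnit v := by
    rw [hp, Algebra.smul_def, (Algebra.commute_algebraMap_left c (v ^ 2)).isUnit_mul_iff] at hu
    exact (isUnit_pow_iff two_ne_zero).1 hu.2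
  obtain ⟨w, hvw, hwv⟩ := isUnit_iff_exists.1 hvu
  have hw := hv.inverse hvw
  have hwu : IsUnit w := isUnit_iff_exists.2 ⟨v, hwv, hvw⟩
  have hsum : w * s * w + w * t * w = c • (1 : Module.End ℝ U) := by
    calc w * s * w + w * t * w = w * (s + t) * w := by noncomm_ring
      _ = c • ((w * v) * (v * w)) := by rw [hp]; simp [pow_two, mul_assoc]
      _ = c • 1 := by rw [hvw, hwv, mul_one]
  have hnu : ∀ r : Module.End ℝ U, IsNilpotent r → ¬ IsUnit (w * r * w) := by
    intro r hr hru
    have : IsUnit r := by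
      obtain ⟨w', rfl⟩ := hwu
      rwa [Units.isUnit_mul_units, Units.isUnit_units_mul] at hru
    exact hr.not_isUnit this
  have hsa : AdjointPair F (w * s * w) (w * s * w) := by
    have := (hw.mul hs).mul hw
    rwa [← mul_assoc] at this
  have hnil := (hF.isNilpotent_or_isUnit hsa).resolve_right (hnu s hs')
  apply hnu t ht'
  have hcu : IsUnit (c • (1 : Module.End ℝ U)) := by
    rw [Algebra.smul_def, mul_one]
    exact (Ne.isUnit hc0).map _
  have := hnil.neg.isUnit_add_left_of_commute hcu
    (by rw [Algebra.smul_def, mul_one]; exact (Algebra.commute_algebraMap_right c _))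
  rwa [← hsum, add_assoc, add_comm (w * t * w), ← add_assoc, add_neg_cancel, zero_add] at this

/-- `P` stands for a family of morphisms `H → L`, each a map together with an adjoint, closed
under addition and such that composing one with the adjoint of another gives an adjoint pair.
If none of them is invertible, then all the selfadjoint
operators `γ ∘ α` are nilpotent; by polarization so is `γ ∘ α' + γ' ∘ α`. -/
theorem bijective_or_trace_add_trace_eq_zero {n : ℕ} {X Y : Type*}
    [AddCommGroup X] [Module ℝ X] [FiniteDimensional ℝ X]
    [AddCommGroup Y] [Module ℝ Y] [FiniteDimensional ℝ Y]
    {H : Form ℝ n X} {L : Form ℝ n Y} (hH : Indecomposable H) (hL : Indecomposable L)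
    (P : (X →ₗ[ℝ] Y) → (Y →ₗ[ℝ] X) → Prop)
    (hadd : ∀ α γ α' γ', P α γ → P α' γ' → P (α + α') (γ + γ'))
    (h1 : ∀ α γ α' γ', P α γ → P α' γ' → AdjointPair H (γ ∘ₗ α') (γ' ∘ₗ α))
    (h2 : ∀ α γ α' γ', P α γ → P α' γ' → AdjointPair L (α ∘ₗ γ') (α' ∘ₗ γ)) :
    (∃ α γ, P α γ ∧ Bijective α ∧ Bijective γ) ∨
      ∀ α γ α' γ', P α γ → P α' γ' →
        LinearMap.trace ℝ X (γ ∘ₗ α') + LinearMap.trace ℝ X (γ' ∘ₗ α) = 0 := by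
  rw [or_iff_not_imp_left]
  intro hno
  have hnil : ∀ α γ, P α γ → IsNilpotent (γ ∘ₗ α : Module.End ℝ X) := by
    intro α γ hP
    rcases subsingleton_or_nontrivial X with hX | hX
    · exact ⟨1, Subsingleton.elim _ _⟩
    refine (hH.isNilpotent_or_isUnit (h1 _ _ _ _ hP hP)).resolve_right fun hu => hno ?_
    have hu' : IsUnit (α ∘ₗ γ : Module.End ℝ Y) := by
      refine (hL.isNilpotent_or_isUnit (h2 _ _ _ _ hP hP)).resolve_left fun ⟨k, hk⟩ => ?_
      have hcomm : ∀ k : ℕ, ((γ ∘ₗ α : Module.End ℝ X) ^ (k + 1))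
          = γ ∘ₗ ((α ∘ₗ γ : Module.End ℝ Y) ^ k) ∘ₗ α := by
        intro k
        induction k with
        | zero => ext; simp
        | succ k ih => rw [pow_succ, ih, pow_succ]; ext; simp
      exact IsNilpotent.not_isUnit ⟨k + 1, by rw [hcomm, hk]; simp⟩ hu
    have b1 : Bijective (γ ∘ α) := (Module.End.isUnit_iff _).1 hu
    have b2 : Bijective (α ∘ γ) := (Module.End.isUnit_iff _).1 hu'
    exact ⟨α, γ, hP, ⟨b1.1.of_comp, b2.2.of_comp⟩, ⟨b2.1.of_comp, b1.2.of_comp⟩⟩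
  intro α γ α' γ' hP hP'
  have hs := hadd _ _ _ _ hP hP'
  have e : (γ ∘ₗ α' + γ' ∘ₗ α : Module.End ℝ X)
      = (γ + γ') ∘ₗ (α + α') + ((-1 : ℝ) • (γ ∘ₗ α) + (-1 : ℝ) • (γ' ∘ₗ α')) := by
    ext; simp; abel
  have hn : ∀ α γ, P α γ → IsNilpotent ((-1 : ℝ) • (γ ∘ₗ α) : Module.End ℝ X) := by
    intro α γ hP
    simpa using (hnil α γ hP).neg
  have hsm : ∀ α γ, P α γ →
      AdjointPair H ((-1 : ℝ) • (γ ∘ₗ α) : Module.End ℝ X) ((-1 : ℝ) • (γ ∘ₗ α)) :=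
    fun α γ hP => (h1 _ _ _ _ hP hP).smul _
  have := hH.isNilpotent_add (h1 _ _ _ _ hs hs) ((hsm _ _ hP).add (hsm _ _ hP')) (hnil _ _ hs)
    (hH.isNilpotent_add (hsm _ _ hP) (hsm _ _ hP') (hn _ _ hP) (hn _ _ hP'))
  rw [← e] at this
  rw [← map_add]
  exact (LinearMap.isNilpotent_trace_of_isNilpotent this).eq_zero

end Trace

/-! ### Projections of a direct sum of forms -/

section Projections

variable {K : Type*} [Field K] {n : ℕ}
variable {U : Type*} [AddCommGroup U] [Module K U]
variable {V : Type*} [AddCommGroup V] [Module K V]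
variable {ι : Type*} [DecidableEq ι] {W : ι → Submodule K U}
variable {κ : Type*} [DecidableEq κ] {W' : κ → Submodule K V}

/-- The projection onto the summand `W a` of an internal direct sum. -/
noncomputable def proj (h : DirectSum.IsInternal W) (a : ι) : U →ₗ[K] W a :=
  DirectSum.component K ι (fun i => W i) a ∘ₗ
    ((LinearEquiv.ofBijective (DirectSum.coeLinearMap W) h).symm : U →ₗ[K] _)

theorem proj_coe_self (h : DirectSum.IsInternal W) (a : ι) (w : W a) : proj h a w = w := by
  have : (LinearEquiv.ofBijective (DirectSum.coeLinearMap W) h).symm w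
      = DirectSum.lof K ι (fun i => W i) a w := by
    rw [LinearEquiv.symm_apply_eq]
    exact (DirectSum.coeLinearMap_lof W a w).symm
  simp [proj, this, DirectSum.component.lof_self]

theorem sum_proj [Fintype ι] (h : DirectSum.IsInternal W) (u : U) :
    ∑ a, (proj h a u : U) = u := by
  classical
  obtain ⟨x, rfl⟩ := (LinearEquiv.ofBijective (DirectSum.coeLinearMap W) h).surjective u
  simp only [proj, LinearMap.comp_apply, LinearEquiv.coe_coe, LinearEquiv.symm_apply_apply]
  refine Eq.trans ?_ (DirectSum.coeLinearMap_eq_dfinsuppSum W x).symm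
  exact (DFinsupp.sum_eq_sum_fintype x fun i => rfl).symm

/-- As soon as one argument lies in `W i`, only the components in `W i` of the others matter. -/
theorem IsDirectSum.apply_update_proj [Fintype ι] {F : Form K n U} (hF : IsDirectSum F W)
    {x : Fin n → U} {a b : Fin n} (hab : a ≠ b) {i : ι} (hx : x a ∈ W i) (u : U) :
    F (update x b (proj hF.isInternal i u)) = F (update x b u) := by
  have hsum := F.map_update_sum Finset.univ b (fun c => (proj hF.isInternal c u : U)) x
  rw [sum_proj] at hsum
  rw [hsum]
  symm
  refine Finset.sum_eq_single_of_mem (M := K) i (Finset.mem_univ _) fun c _ hc => ?_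
  exact hF.eq_zero i c hc.symm _ a b (by simpa [hab] using hx) (by simp)

theorem IsDirectSum.apply_proj [Fintype ι] {F : Form K n U} (hF : IsDirectSum F W)
    {x : Fin n → U} {a : Fin n} {i : ι} (hx : x a ∈ W i) :
    F (fun k => (proj hF.isInternal i (x k) : U)) = F x := by
  have h : ∀ S : Finset (Fin n),
      F (S.piecewise (fun k => (proj hF.isInternal i (x k) : U)) x) = F x := by
    intro S
    induction S using Finset.induction_on with
    | empty => simp
    | insert b S hb ih =>
      rw [Finset.piecewise_insert, ← ih]
      have hpa : ((proj hF.isInternal i (x a) : W i) : U) = x a :=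
        congrArg Subtype.val (proj_coe_self hF.isInternal i ⟨x a, hx⟩)
      set y := S.piecewise (fun k => (proj hF.isInternal i (x k) : U)) x
      have hya : y a ∈ W i := by
        by_cases ha : a ∈ S
        · simp [y, ha]
        · simpa [y, ha] using hx
      have hyb : y b = x b := by simp [y, hb]
      by_cases hab : a = b
      · subst hab
        rw [hpa, ← hyb, update_eq_self]
      · rw [hF.apply_update_proj hab hya, ← hyb, update_eq_self]
  simpa using h Finset.univ

theorem IsDirectSum.mem_radical [Fintype ι] {F : Form K n U} (hF : IsDirectSum F W) {i : ι}
    (h0 : restrict F (W i) = 0) : W i ≤ radical F := by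
  intro u hu x b
  rw [← hF.apply_proj (x := update x b u) (a := b) (i := i) (by simpa using hu)]
  exact congrArg (fun f : Form K n (W i) => f fun k => proj hF.isInternal i (update x b u k)) h0

theorem IsDirectSum.proj_eq_zero [Fintype ι] {F : Form K n U} (hF : IsDirectSum F W)
    (hn : 2 ≤ n) {i : ι} (hi : radical (restrict F (W i)) = ⊥) {u : U} (hu : u ∈ radical F) :
    proj hF.isInternal i u = 0 := by
  rw [← Submodule.mem_bot (R := K), ← hi]
  intro x b
  have : Nontrivial (Fin n) := Fin.nontrivial_iff_two_le.2 hn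
  obtain ⟨a, hab⟩ := exists_ne b
  have e : (fun k => ((update x b (proj hF.isInternal i u) k : W i) : U))
      = update (fun k => (x k : U)) b (proj hF.isInternal i u : U) := by
    funext k
    by_cases hk : k = b
    · subst hk; simp
    · simp [hk]
  change F (fun k => ((update x b (proj hF.isInternal i u) k : W i) : U)) = 0
  rw [e, hF.apply_update_proj hab (by simp)]
  exact hu _ _

/-- The trace of `W i → W' j → W i`, where the maps are the blocks of `θ` and of `θ⁻¹`. -/
noncomputable def blockTrace (h : DirectSum.IsInternal W) (h' : DirectSum.IsInternal W')
    (θ : U ≃ₗ[K] V) (i : ι) (j : κ) : K :=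
  LinearMap.trace K (W i)
    ((proj h i ∘ₗ (θ.symm : V →ₗ[K] U) ∘ₗ (W' j).subtype) ∘ₗ
      (proj h' j ∘ₗ (θ : U →ₗ[K] V) ∘ₗ (W i).subtype))

theorem sum_blockTrace [FiniteDimensional K U] [Fintype κ] (h : DirectSum.IsInternal W)
    (h' : DirectSum.IsInternal W') (θ : U ≃ₗ[K] V) (i : ι) :
    ∑ j, blockTrace h h' θ i j = Module.finrank K (W i) := by
  rw [← LinearMap.trace_id K (W i)]
  simp only [blockTrace]
  rw [← map_sum]
  congr 1
  ext w
  have : ∑ j, proj h i (θ.symm (proj h' j (θ w) : V)) = w := by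
    rw [← map_sum, ← map_sum, sum_proj, LinearEquiv.symm_apply_apply, proj_coe_self]
  simpa [LinearMap.sum_apply] using congrArg Subtype.val this

theorem blockTrace_symm [FiniteDimensional K U] [FiniteDimensional K V]
    (h : DirectSum.IsInternal W) (h' : DirectSum.IsInternal W')
    (θ : U ≃ₗ[K] V) (i : ι) (j : κ) : blockTrace h' h θ.symm j i = blockTrace h h' θ i j := by
  rw [blockTrace, LinearMap.trace_comp_comm', blockTrace, LinearEquiv.symm_symm]

end Projections

/-! ### Adjoint pairs along a symmetric equivalence -/

section Transfer

variable {K : Type*} [Field K] {n : ℕ}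
variable {U : Type*} [AddCommGroup U] [Module K U]
variable {V : Type*} [AddCommGroup V] [Module K V]

theorem restrict_update (F : Form K n U) (X : Submodule K U) (x : Fin n → X) (a : Fin n)
    (y : X) : restrict F X (update x a y) = F (update (fun k => (x k : U)) a y) := by
  change F (fun k => ((update x a y k : X) : U)) = _
  congr 1
  funext k
  by_cases hk : k = a
  · subst hk; simp
  · simp [hk]

/-- `α` and `γ` are adjoint with respect to `F` and `G` when the remaining arguments are
transported by the bijections `φ k`, `k ≠ p, q`, in any order. The remaining arguments range over
all of `U`, so that their images range over all of `V`; this is what makes `α ∘ γ` selfadjoint for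
`G|Y` as well as `γ ∘ α` for `F|X`. -/
def AdjointAlong (F : Form K n U) (G : Form K n V) (φ : Fin n → (U ≃ₗ[K] V)) (p q : Fin n)
    (X : Submodule K U) (Y : Submodule K V) (α : X →ₗ[K] Y) (γ : Y →ₗ[K] X) : Prop :=
  ∀ (σ : Equiv.Perm (Fin n)) (a b : Fin n), a ≠ b →
    (σ a = p ∧ σ b = q ∨ σ a = q ∧ σ b = p) → ∀ (x : X) (y : Y) (w : Fin n → U),
    F (update (update w a x) b (γ y)) =
      G (update (update (fun k => φ (σ k) (w k)) a (α x)) b y)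

namespace AdjointAlong

variable {F : Form K n U} {G : Form K n V} {φ : Fin n → (U ≃ₗ[K] V)} {p q : Fin n}
  {X : Submodule K U} {Y : Submodule K V} {α α' : X →ₗ[K] Y} {γ γ' : Y →ₗ[K] X}

theorem swap (h : AdjointAlong F G φ p q X Y α γ) : AdjointAlong F G φ q p X Y α γ :=
  fun σ a b hab hσ => h σ a b hab hσ.symm

theorem add (h : AdjointAlong F G φ p q X Y α γ) (h' : AdjointAlong F G φ p q X Y α' γ') :
    AdjointAlong F G φ p q X Y (α + α') (γ + γ') := by
  intro σ a b hab hσ x y w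
  have h1 := h σ a b hab hσ x y w
  have h2 := h' σ a b hab hσ x y w
  simp only [LinearMap.add_apply, Submodule.coe_add]
  rw [F.map_update_add, h1, h2, update_comm hab, update_comm hab, update_comm hab,
    G.map_update_add]

theorem adjointPair_left (hpq : p ≠ q) (h : AdjointAlong F G φ p q X Y α γ)
    (h' : AdjointAlong F G φ p q X Y α' γ') :
    AdjointPair (restrict F X) (γ ∘ₗ α') (γ' ∘ₗ α) := by
  intro x a b hab
  obtain ⟨σ, ha, hb⟩ := exists_perm_apply_eq hab hpq
  have h1 := h σ b a hab.symm (Or.inr ⟨hb, ha⟩) (x b) (α' (x a)) (fun k => x k)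
  have h2 := h' σ a b hab (Or.inl ⟨ha, hb⟩) (x a) (α (x b)) (fun k => x k)
  rw [update_eq_self b (fun k => (x k : U))] at h1
  rw [update_eq_self a (fun k => (x k : U))] at h2
  rw [restrict_update, restrict_update, LinearMap.comp_apply, LinearMap.comp_apply, h1, h2,
    update_comm hab]

theorem adjointPair_right (hpq : p ≠ q) (h : AdjointAlong F G φ p q X Y α γ)
    (h' : AdjointAlong F G φ p q X Y α' γ') :
    AdjointPair (restrict G Y) (α ∘ₗ γ') (α' ∘ₗ γ) := by
  intro y a b hab
  obtain ⟨σ, ha, hb⟩ := exists_perm_apply_eq hab hpq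
  have h1 := h σ a b hab (Or.inl ⟨ha, hb⟩) (γ' (y a)) (y b) (fun k => (φ (σ k)).symm (y k))
  have h2 := h' σ b a hab.symm (Or.inr ⟨hb, ha⟩) (γ (y b)) (y a)
    (fun k => (φ (σ k)).symm (y k))
  simp only [LinearEquiv.apply_symm_apply] at h1 h2
  have e1 := update_comm hab (α (γ' (y a)) : V) (y b : V) (fun k => (y k : V))
  have e2 := update_comm hab.symm (α' (γ (y b)) : V) (y a : V) (fun k => (y k : V))
  rw [update_eq_self b (fun k => (y k : V))] at e1
  rw [update_eq_self a (fun k => (y k : V))] at e2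
  rw [restrict_update, restrict_update, LinearMap.comp_apply, LinearMap.comp_apply, ← e1, ← e2,
    ← h1, ← h2, update_comm hab]

end AdjointAlong

variable {ι : Type*} [DecidableEq ι] [Fintype ι] {W : ι → Submodule K U}
variable {κ : Type*} [DecidableEq κ] [Fintype κ] {W' : κ → Submodule K V}
variable {F : Form K n U} {G : Form K n V} {φ : Fin n → (U ≃ₗ[K] V)}

/-- The blocks of `φ p` and of `(φ q)⁻¹` between two summands are adjoint. -/
theorem adjointAlong_proj (hF : IsDirectSum F W) (hG : IsDirectSum G W')
    (hφ : ∀ (σ : Equiv.Perm (Fin n)) (u : Fin n → U), F u = G (fun k => φ (σ k) (u k)))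
    (p q : Fin n) (i : ι) (j : κ) :
    AdjointAlong F G φ p q (W i) (W' j)
      (proj hG.isInternal j ∘ₗ (φ p : U →ₗ[K] V) ∘ₗ (W i).subtype)
      (proj hF.isInternal i ∘ₗ ((φ q).symm : V →ₗ[K] U) ∘ₗ (W' j).subtype) := by
  intro σ a b hab hσ x y w
  have key : ∀ τ : Equiv.Perm (Fin n), τ a = p → τ b = q →
      (∀ k, k ≠ a → k ≠ b → τ k = σ k) →
      F (update (update w a (x : U)) b ((φ q).symm y)) =
      G (update (update (fun k => φ (σ k) (w k)) a (φ p x)) b y) := by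
    intro τ ha hb hτ
    rw [hφ τ]
    congr 1
    funext k
    by_cases hkb : k = b
    · subst hkb; simp [hb]
    · by_cases hka : k = a
      · subst hka; simp [ha, hab]
      · simp [hka, hkb, hτ k hka hkb]
  have key' : F (update (update w a (x : U)) b ((φ q).symm y)) =
      G (update (update (fun k => φ (σ k) (w k)) a (φ p x)) b y) := by
    rcases hσ with ⟨ha, hb⟩ | ⟨ha, hb⟩
    · exact key σ ha hb fun _ _ _ => rfl
    · exact key (σ * Equiv.swap a b) (by simp [hb]) (by simp [ha])
        fun k hka hkb => by simp [Equiv.swap_apply_of_ne_of_ne hka hkb]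
  simp only [LinearMap.comp_apply, Submodule.subtype_apply, LinearEquiv.coe_coe]
  rw [hF.apply_update_proj hab (by simp), key', update_comm hab, update_comm hab,
    hG.apply_update_proj hab.symm (by simp)]

/-- An invertible adjoint pair `α`, `γ` yields a symmetric equivalence: take `α` and `γ⁻¹` in place
of `φ p` and `φ q`, and the blocks of the other `φ k`. The latter are injective because the radical
of `F|X` is zero. -/
theorem symmetricallyEquivalent_of_adjointAlong [FiniteDimensional K U] [FiniteDimensional K V]
    (hG : IsDirectSum G W')
    {p q : Fin n} (hpq : p ≠ q) {X : Submodule K U} {j : κ}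
    (hrad : radical (restrict F X) = ⊥) {α : X →ₗ[K] W' j} {γ : W' j →ₗ[K] X}
    (h : AdjointAlong F G φ p q X (W' j) α γ) (hα : Bijective α) (hγ : Bijective γ) :
    SymmetricallyEquivalent (restrict F X) (restrict G (W' j)) := by
  let γe := LinearEquiv.ofBijective γ hγ
  let ψ : Fin n → (X →ₗ[K] W' j) := fun k =>
    if k = p then α else if k = q then (γe.symm : X →ₗ[K] W' j)
    else proj hG.isInternal j ∘ₗ (φ k : U →ₗ[K] V) ∘ₗ X.subtype
  have hψ : ∀ (σ : Equiv.Perm (Fin n)) (u : Fin n → X),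
      restrict F X u = restrict G (W' j) (fun k => ψ (σ k) (u k)) := by
    intro σ u
    have hab : σ.symm p ≠ σ.symm q := fun e => hpq (σ.symm.injective e)
    have h1 := h σ (σ.symm p) (σ.symm q) hab (Or.inl (by simp)) (u (σ.symm p))
      (γe.symm (u (σ.symm q))) (fun k => u k)
    have hγe : γ (γe.symm (u (σ.symm q))) = u (σ.symm q) := γe.apply_symm_apply _
    rw [hγe, update_eq_self (σ.symm p) (fun k => (u k : U)),
      update_eq_self (σ.symm q) (fun k => (u k : U)),
      ← hG.apply_proj (a := σ.symm p) (i := j) (by simp [hab])] at h1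
    refine Eq.trans h1 (congrArg G ?_)
    funext k
    by_cases hkq : k = σ.symm q
    · subst hkq; simp [ψ, hpq.symm, proj_coe_self]
    · have hkq' : σ k ≠ q := fun e => hkq (by simp [← e])
      by_cases hkp : k = σ.symm p
      · subst hkp; simp [ψ, hab, proj_coe_self]
      · have hkp' : σ k ≠ p := fun e => hkp (by simp [← e])
        simp [ψ, hkq, hkp, hkq', hkp']
  -- A vector killed by `ψ k` lies in the radical, as `ψ k` can be moved to any position.
  have hinj : ∀ k, Injective (ψ k) := by
    intro k
    rw [← LinearMap.ker_eq_bot, eq_bot_iff, ← hrad]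
    intro u hu x a
    rw [hψ (Equiv.swap a k)]
    exact MultilinearMap.map_coord_zero _ a (by simpa using hu)
  have hdim : Module.finrank K X = Module.finrank K (W' j) :=
    (LinearEquiv.ofBijective α hα).finrank_eq
  exact ⟨fun k => LinearEquiv.ofInjectiveOfFinrankEq (ψ k) (hinj k) hdim,
    fun σ u => by rw [hψ σ u]; rfl⟩

theorem mem_radical_of_symmetric
    (hφ : ∀ (σ : Equiv.Perm (Fin n)) (u : Fin n → U), F u = G (fun k => φ (σ k) (u k)))
    (p : Fin n) (u : U) : φ p u ∈ radical G ↔ u ∈ radical F := by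
  have upd : ∀ (σ : Equiv.Perm (Fin n)) (x : Fin n → U) (a : Fin n), σ a = p →
      F (update x a u) = G (update (fun k => φ (σ k) (x k)) a (φ p u)) := by
    intro σ x a ha
    rw [hφ σ]
    congr 1
    funext k
    by_cases hk : k = a
    · subst hk; simp [ha]
    · simp [hk]
  constructor
  · intro h x a
    rw [upd (Equiv.swap a p) x a (by simp)]
    exact h _ _
  · intro h y a
    have := upd (Equiv.swap a p) (fun k => (φ (Equiv.swap a p k)).symm (y k)) a (by simp)
    simp only [LinearEquiv.apply_symm_apply] at this
    rw [← this]
    exact h _ _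

theorem blockTrace_eq_zero_of_radical (hn : 2 ≤ n) (hF : IsDirectSum F W)
    (hG : IsDirectSum G W')
    (hφ : ∀ (σ : Equiv.Perm (Fin n)) (u : Fin n → U), F u = G (fun k => φ (σ k) (u k)))
    (p : Fin n) {i : ι} {j : κ} (hi : radical (restrict F (W i)) = ⊥)
    (hj : restrict G (W' j) = 0) :
    blockTrace hF.isInternal hG.isInternal (φ p) i j = 0 := by
  have : proj hF.isInternal i ∘ₗ ((φ p).symm : V →ₗ[K] U) ∘ₗ (W' j).subtype = 0 := by
    ext y
    have hy : (φ p).symm y ∈ radical F := by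
      rw [← mem_radical_of_symmetric hφ p, LinearEquiv.apply_symm_apply]
      exact hG.mem_radical hj y.2
    simp [hF.proj_eq_zero hn hi hy]
  rw [blockTrace, this, LinearMap.zero_comp, map_zero]

end Transfer

section Real

variable {n : ℕ} {U V : Type*} [AddCommGroup U] [Module ℝ U] [FiniteDimensional ℝ U]
  [AddCommGroup V] [Module ℝ V] [FiniteDimensional ℝ V]

/-- Summands that are not congruent up to sign are invisible to each other in the trace. -/
theorem blockTrace_add_eq_zero {ι κ : Type*} [DecidableEq ι] [Fintype ι] [DecidableEq κ]
    [Fintype κ] {W : ι → Submodule ℝ U} {W' : κ → Submodule ℝ V}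
    {F : Form ℝ n U} {G : Form ℝ n V} {φ : Fin n → (U ≃ₗ[ℝ] V)}
    (hn : 0 < n) (hF : IsDirectSum F W) (hG : IsDirectSum G W')
    (hφ : ∀ (σ : Equiv.Perm (Fin n)) (u : Fin n → U), F u = G (fun k => φ (σ k) (u k)))
    {p q : Fin n} (hpq : p ≠ q) {i : ι} {j : κ}
    (hi : Indecomposable (restrict F (W i))) (hi0 : restrict F (W i) ≠ 0)
    (hj : Indecomposable (restrict G (W' j)))
    (hno : ¬ SignCongruent (restrict F (W i)) (restrict G (W' j))) :
    blockTrace hF.isInternal hG.isInternal (φ p) i j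
      + blockTrace hF.isInternal hG.isInternal (φ q) i j = 0 := by
  rcases bijective_or_trace_add_trace_eq_zero hi hj (AdjointAlong F G φ p q (W i) (W' j))
    (fun _ _ _ _ h h' => h.add h') (fun _ _ _ _ h h' => h.adjointPair_left hpq h')
    (fun _ _ _ _ h h' => h.adjointPair_right hpq h') with ⟨α, γ, h, hα, hγ⟩ | h
  · exact absurd (hj.signCongruent hn (symmetricallyEquivalent_of_adjointAlong hG hpq
      (hi.radical_eq_bot hn hi0) h hα hγ)) hno
  · exact h _ _ _ _ (adjointAlong_proj hF hG hφ q p i j).swap (adjointAlong_proj hF hG hφ p q i j)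

end Real

/-! ### Matching the indecomposable summands -/

theorem exists_equiv_of_card_fiber_eq {A B Q : Type*} [Fintype A] [Fintype B]
    (f : A → Q) (g : B → Q)
    (h : ∀ c, Nat.card {a // f a = c} = Nat.card {b // g b = c}) :
    ∃ e : A ≃ B, ∀ a, g (e a) = f a := by
  have e : ∀ c, Nonempty ({a // f a = c} ≃ {b // g b = c}) := fun c => Finite.card_eq.1 (h c)
  refine ⟨(Equiv.sigmaFiberEquiv f).symm.trans
    ((Equiv.sigmaCongrRight fun c => (e c).some).trans (Equiv.sigmaFiberEquiv g)), fun a => ?_⟩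
  exact ((e (f a)).some ⟨a, rfl⟩).2

section Real

variable {n : ℕ} {U V : Type*} [AddCommGroup U] [Module ℝ U] [FiniteDimensional ℝ U]
  [AddCommGroup V] [Module ℝ V] [FiniteDimensional ℝ V]

/-- The block traces `T i j` sum to `2 dim (U' i)` along rows and to `2 dim (V' j)` along columns, and
vanish unless `U' i` and `V' j` carry forms congruent up to sign. Summing them over one class of
forms shows that it occurs equally often in both decompositions. -/
theorem SymmetricallyEquivalent.exists_equiv_signCongruent (hn : 2 ≤ n)
    {F : Form ℝ n U} {G : Form ℝ n V} (h : SymmetricallyEquivalent F G) {s r : ℕ}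
    {U' : Fin s → Submodule ℝ U} {U₀ : Submodule ℝ U}
    {V' : Fin r → Submodule ℝ V} {V₀ : Submodule ℝ V}
    (hF : IsIndecomposableDecomposition F U' U₀) (hG : IsIndecomposableDecomposition G V' V₀) :
    ∃ e : Fin s ≃ Fin r, ∀ i, SignCongruent (restrict F (U' i)) (restrict G (V' (e i))) := by
  classical
  obtain ⟨φ, hφ⟩ := h
  have hφ' : ∀ (σ : Equiv.Perm (Fin n)) (v : Fin n → V),
      G v = F (fun k => (φ (σ k)).symm (v k)) := by
    intro σ v
    rw [hφ σ]
    simp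
  have hn0 : 0 < n := by omega
  let p : Fin n := ⟨0, by omega⟩
  let q : Fin n := ⟨1, by omega⟩
  have hpq : p ≠ q := by simp [p, q]
  have dF := hF.isDirectSum
  have dG := hG.isDirectSum
  let T : Option (Fin s) → Option (Fin r) → ℝ := fun i j =>
    blockTrace dF.isInternal dG.isInternal (φ p) i j
      + blockTrace dF.isInternal dG.isInternal (φ q) i j
  have hTr : ∀ i : Fin s, T (some i) none = 0 := by
    intro i
    have hi := (hF.indecomposable i).radical_eq_bot hn0 (hF.ne_zero i)
    simp only [T]
    rw [blockTrace_eq_zero_of_radical hn dF dG hφ p (i := some i) (j := none) hi hG.eq_zero,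
      blockTrace_eq_zero_of_radical hn dF dG hφ q (i := some i) (j := none) hi hG.eq_zero,
      add_zero]
  have hTl : ∀ j : Fin r, T none (some j) = 0 := by
    intro j
    have hj := (hG.indecomposable j).radical_eq_bot hn0 (hG.ne_zero j)
    simp only [T]
    rw [← blockTrace_symm, ← blockTrace_symm dF.isInternal dG.isInternal (φ q),
      blockTrace_eq_zero_of_radical (φ := fun k => (φ k).symm) hn dG dF hφ' p
        (i := some j) (j := none) hj hF.eq_zero,
      blockTrace_eq_zero_of_radical (φ := fun k => (φ k).symm) hn dG dF hφ' q
        (i := some j) (j := none) hj hF.eq_zero,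
      add_zero]
  have hrow : ∀ i : Fin s,
      ∑ j : Fin r, T (some i) (some j) = 2 * Module.finrank ℝ (U' i) := by
    intro i
    have h1 := sum_blockTrace dF.isInternal dG.isInternal (φ p) (some i)
    have h2 := sum_blockTrace dF.isInternal dG.isInternal (φ q) (some i)
    have h3 : ∑ j, T (some i) j = 2 * Module.finrank ℝ (U' i) := by
      simp only [T, Finset.sum_add_distrib, h1, h2]
      rw [two_mul]
      rfl
    rwa [Fintype.sum_option, hTr, zero_add] at h3
  have hcol : ∀ j : Fin r,
      ∑ i : Fin s, T (some i) (some j) = 2 * Module.finrank ℝ (V' j) := by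
    intro j
    have h1 := sum_blockTrace dG.isInternal dF.isInternal (φ p).symm (some j)
    have h2 := sum_blockTrace dG.isInternal dF.isInternal (φ q).symm (some j)
    have h3 : ∑ i, T i (some j) = 2 * Module.finrank ℝ (V' j) := by
      simp only [T, Finset.sum_add_distrib]
      simp only [← blockTrace_symm dF.isInternal dG.isInternal, h1, h2]
      rw [two_mul]
      rfl
    rwa [Fintype.sum_option, hTl, zero_add] at h3
  let R : Fin s → Fin r → Prop := fun i j =>
    SignCongruent (restrict F (U' i)) (restrict G (V' j))
  let E : Fin r → Fin r → Prop := fun j j' =>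
    SignCongruent (restrict G (V' j)) (restrict G (V' j'))
  have hT0 : ∀ i j, ¬ R i j → T (some i) (some j) = 0 := fun i j hij =>
    blockTrace_add_eq_zero (i := some i) (j := some j) hn0 dF dG hφ hpq (hF.indecomposable i)
      (hF.ne_zero i) (hG.indecomposable j) hij
  have hpos : ∀ i : Fin s, 0 < Module.finrank ℝ (U' i) := by
    intro i
    rw [Nat.pos_iff_ne_zero]
    intro h0
    have := Module.finrank_zero_iff.1 h0
    apply hF.ne_zero i
    ext x
    exact MultilinearMap.map_coord_zero _ p (Subsingleton.elim _ _)
  have hex : ∀ i, ∃ j, R i j := by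
    intro i
    by_contra! hno
    have := hrow i
    rw [Finset.sum_eq_zero fun j _ => hT0 i j (hno j)] at this
    have hp := hpos i
    have : (Module.finrank ℝ (U' i) : ℝ) = 0 := by linarith
    norm_cast at this
    omega
  have hex' : ∀ j, ∃ i, R i j := by
    intro j
    by_contra! hno
    have := hcol j
    rw [Finset.sum_eq_zero fun i _ => hT0 i j (hno i)] at this
    have h0 : (Module.finrank ℝ (V' j) : ℝ) = 0 := by linarith
    norm_cast at h0
    have := Module.finrank_zero_iff.1 h0
    apply hG.ne_zero j
    ext x
    exact MultilinearMap.map_coord_zero _ p (Subsingleton.elim _ _)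
  have hcard : ∀ j, Nat.card {i // R i j} = Nat.card {j' // E j j'} := by
    intro j
    obtain ⟨i₀, hi₀⟩ := hex' j
    -- Both sides are the sum of `T` over the block of the class of `V' j`.
    have h1 : ∑ i with R i j, ∑ j', T (some i) (some j')
        = ∑ j' with E j j', ∑ i, T (some i) (some j') := by
      have h2 : ∀ i ∈ Finset.univ.filter (R · j), ∑ j', T (some i) (some j')
          = ∑ j' with E j j', T (some i) (some j') := by
        intro i hi
        rw [Finset.mem_filter] at hi
        rw [Finset.sum_filter]
        refine Finset.sum_congr rfl fun j' _ => ?_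
        split_ifs with hj'
        · rfl
        · exact hT0 _ _ fun hij => hj' (hi.2.symm.trans hij)
      have h3 : ∀ j' ∈ Finset.univ.filter (E j ·), ∑ i, T (some i) (some j')
          = ∑ i with R i j, T (some i) (some j') := by
        intro j' hj'
        rw [Finset.mem_filter] at hj'
        rw [Finset.sum_filter]
        refine Finset.sum_congr rfl fun i _ => ?_
        split_ifs with hi
        · rfl
        · exact hT0 _ _ fun hij => hi (hij.trans hj'.2.symm)
      rw [Finset.sum_congr rfl h2, Finset.sum_congr rfl h3, Finset.sum_comm]
    have h4 : ∑ i with R i j, ∑ j', T (some i) (some j')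
        = (Finset.univ.filter (R · j)).card • (2 * Module.finrank ℝ (V' j) : ℝ) := by
      refine Finset.sum_eq_card_nsmul fun i hi => ?_
      rw [hrow, (Finset.mem_filter.1 hi).2.finrank_eq]
    have h5 : ∑ j' with E j j', ∑ i, T (some i) (some j')
        = (Finset.univ.filter (E j ·)).card • (2 * Module.finrank ℝ (V' j) : ℝ) := by
      refine Finset.sum_eq_card_nsmul fun j' hj' => ?_
      rw [hcol, (Finset.mem_filter.1 hj').2.finrank_eq]
    have hd : (2 * Module.finrank ℝ (V' j) : ℝ) ≠ 0 := by
      rw [← hi₀.finrank_eq]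
      exact mul_ne_zero two_ne_zero (by exact_mod_cast (hpos i₀).ne')
    rw [h4, h5, nsmul_eq_mul, nsmul_eq_mul] at h1
    have h6 := mul_right_cancel₀ hd h1
    rw [Nat.card_eq_fintype_card, Nat.card_eq_fintype_card, Fintype.card_subtype,
      Fintype.card_subtype]
    exact_mod_cast h6
  -- The class of a summand is encoded as the set of the summands of `G` that belong to it.
  have hRE : ∀ i j, {j' | R i j'} = {j' | E j j'} ↔ R i j := by
    intro i j
    constructor
    · intro h
      have : j ∈ {j' | R i j'} := by rw [h]; exact SignCongruent.refl _
      exact this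
    · intro h
      ext j'
      exact ⟨fun h' => h.symm.trans h', fun h' => h.trans h'⟩
  have hEE : ∀ j j', {j'' | E j' j''} = {j'' | E j j''} ↔ E j j' := by
    intro j j'
    constructor
    · intro h
      have : j' ∈ {j'' | E j j''} := by rw [← h]; exact SignCongruent.refl _
      exact this
    · intro h
      ext j''
      exact ⟨fun h' => h.trans h', fun h' => h.symm.trans h'⟩
  obtain ⟨e, he⟩ := exists_equiv_of_card_fiber_eq (fun i => {j | R i j}) (fun j => {j' | E j j'})
    (by
      intro c
      by_cases hc : ∃ j, {j' | E j j'} = c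
      · obtain ⟨j, rfl⟩ := hc
        simp only [hRE, hEE]
        exact hcard j
      · have : IsEmpty {j // {j' | E j j'} = c} := ⟨fun j => hc ⟨j.1, j.2⟩⟩
        have : IsEmpty {i // {j | R i j} = c} := ⟨fun i => by
          obtain ⟨j, hj⟩ := hex i.1
          exact hc ⟨j, ((hRE i.1 j).2 hj).symm.trans i.2⟩⟩
        simp)
  exact ⟨e, fun i => (hRE i (e i)).1 (he i).symm⟩

end Real

end MultilinearForm

theorem theorem1 (n : ℕ) (hn : 2 ≤ n) :
    (∀ (U V : Type*) [AddCommGroup U] [Module ℂ U] [FiniteDimensional ℂ U]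
        [AddCommGroup V] [Module ℂ V] [FiniteDimensional ℂ V]
        (F : MultilinearForm.Form ℂ n U) (G : MultilinearForm.Form ℂ n V),
        MultilinearForm.SymmetricallyEquivalent F G → MultilinearForm.Congruent F G) ∧
    (∀ (U V : Type*) [AddCommGroup U] [Module ℝ U] [FiniteDimensional ℝ U]
        [AddCommGroup V] [Module ℝ V] [FiniteDimensional ℝ V]
        (F : MultilinearForm.Form ℝ n U) (G : MultilinearForm.Form ℝ n V),
        MultilinearForm.SymmetricallyEquivalent F G →
        ∀ (s r : ℕ) (U' : Fin s → Submodule ℝ U) (U₀ : Submodule ℝ U)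
          (V' : Fin r → Submodule ℝ V) (V₀ : Submodule ℝ V),
          MultilinearForm.IsIndecomposableDecomposition F U' U₀ →
          MultilinearForm.IsIndecomposableDecomposition G V' V₀ →
          s = r ∧ ∃ e : Fin s ≃ Fin r, ∀ i : Fin s,
            MultilinearForm.Congruent
              (MultilinearForm.restrict F (U' i)) (MultilinearForm.restrict G (V' (e i))) ∨
            MultilinearForm.Congruent
              (MultilinearForm.restrict F (U' i)) (-MultilinearForm.restrict G (V' (e i)))) := by
  refine ⟨fun U V _ _ _ _ _ _ F G h =>
    MultilinearForm.congruent_of_symmetricallyEquivalent_complex (by omega) h, ?_⟩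
  intro U V _ _ _ _ _ _ F G h s r U' U₀ V' V₀ hF hG
  obtain ⟨e, he⟩ := h.exists_equiv_signCongruent hn hF hG
  exact ⟨by simpa using Fintype.card_congr e, e, he⟩
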